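/- Let $G$ be a compactly generated, totally disconnected, locally compact topological group, meaning that the topology of $G$ is locally compact and totally disconnected and that some compact subset generates $G$ as an abstract group. Suppose that $G$ is topologically characteristically simple, i.e. that the only closed subgroups of $G$ invariant under all automorphisms of $G$ as a topological group are $\{e\}$ and $G$. Suppose moreover that $G$ is neither discrete nor compact. Then the following hold. (i) The quasi-centre $\mathrm{QZ}(G)$, that is, the subgroup consisting of all elements of $G$ whose centraliser is open in $G$, is trivial. (ii) The only virtually soluble locally normal subgroup of $G$ is the identity subgroup $\{e\}$. Here a subgroup of $G$ is locally normal if it is compact and its normaliser in $G$ is open, and a group is virtually soluble if it has a soluble subgroup of finite index. -/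

import Mathlib

namespace TDLC

/-- A topological group is compactly generated if some compact subset generates it as an
abstract group. -/
def IsCompactlyGeneratedGroup (G : Type*) [Group G] [TopologicalSpace G] : Prop :=
  ∃ C : Set G, IsCompact C ∧ Subgroup.closure C = ⊤

/-- A topological group is topologically characteristically simple if its only closed subgroups
invariant under all automorphisms of the topological group (group automorphisms that are
homeomorphisms) are the trivial subgroup and the whole group. -/
def IsTopCharSimple (G : Type*) [Group G] [TopologicalSpace G] : Prop :=
  ∀ H : Subgroup G, IsClosed (H : Set G) →
    (∀ φ : G ≃ₜ* G, H.map (φ.toMulEquiv : G →* G) = H) → H = ⊥ ∨ H = ⊤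

/-- The quasi-centre of a topological group: the subgroup of all elements whose centraliser
is open. -/
def quasiCentre (G : Type*) [Group G] [TopologicalSpace G] [IsTopologicalGroup G] :
    Subgroup G where
  carrier := {g | IsOpen (Subgroup.centralizer ({g} : Set G) : Set G)}
  one_mem' := by
    have h : Subgroup.centralizer ({1} : Set G) = ⊤ := by
      ext x
      simp [Subgroup.mem_centralizer_singleton_iff]
    simp [h]
  mul_mem' := by
    intro a b ha hb
    have hab : IsOpen ((Subgroup.centralizer ({a} : Set G) ⊓
        Subgroup.centralizer ({b} : Set G) : Subgroup G) : Set G) := ha.inter hb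
    refine Subgroup.isOpen_mono ?_ hab
    intro x hx
    rw [Subgroup.mem_inf, Subgroup.mem_centralizer_singleton_iff,
      Subgroup.mem_centralizer_singleton_iff] at hx
    rw [Subgroup.mem_centralizer_singleton_iff]
    exact Commute.mul_right hx.1 hx.2
  inv_mem' := by
    intro a ha
    refine Subgroup.isOpen_mono ?_ ha
    intro x hx
    rw [Subgroup.mem_centralizer_singleton_iff] at hx ⊢
    exact Commute.inv_right hx

/-- A subgroup is locally normal if it is compact and its normaliser is open. -/
def IsLocallyNormal {G : Type*} [Group G] [TopologicalSpace G] (K : Subgroup G) : Prop :=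
  IsCompact (K : Set G) ∧ IsOpen (Subgroup.normalizer (K : Set G) : Set G)

/-- A group is virtually soluble if it has a soluble subgroup of finite index. -/
def IsVirtuallySoluble (G : Type*) [Group G] : Prop :=
  ∃ N : Subgroup G, Group.IsSolvable N ∧ N.FiniteIndex

end TDLC

/-!
The argument excludes, one after the other, compact normal subgroups, elements of the quasi-centre,
and abelian locally normal subgroups.

The tool used throughout is this. If a subset of `G` stable under all automorphisms contains a
nontrivial element, it generates a dense subgroup by topological characteristic simplicity, and
compact generation then yields finitely many elements `f` of the subset which generate `G` together
with a compact open subgroup `U` (`exists_finset_closure_eq_top`). Applied to the union of the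
compact normal subgroups, this writes `G` as a product of two compact subgroups, so there are no
nontrivial ones (`eq_bot_of_isCompact_of_normal`). Consequently, if `B` is a locally normal subgroup
which agrees with each of its conjugates near the identity (`localStabilizer B = ⊤`), and if the
generators `f` all centralise `B` near the identity, then `B` is discrete: the intersection of
the `U`-conjugates of a small open subgroup of `B` is compact and normal in `G`
(`eventually_mem_eq_one`). With `B = U` and generators in the quasi-centre, this proves that the
quasi-centre is trivial; it follows that discrete subgroups with open normaliser are trivial.

Let `A` be a nontrivial abelian locally normal subgroup, and choose generators `f` in images `A_f`
of `A` under automorphisms. Let `V` be an open normal subgroup of `U` normalising all `A_f`, and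
let `E` be the closure of the group generated by the `U`-conjugates of the groups `A_f ⊓ V`. If `y`
is close to the identity, then the commutator of `f` and `y` lies in `A_f ⊓ V`, since `y` normalises
`A_f`; so `f` locally stabilises `E`, and hence so does `G`. Moreover `E` has nontrivial centre: a
maximal nontrivial intersection of the finitely many conjugates is centralised by all of them
(`exists_localStabilizer_eq_top`). Repeat this with the centre of `E` in place of `A`: choose
generators `f` in the centres of images `E_f` of `E`, and let `B` be a maximal nontrivial
intersection of the `E_f`. If `E_f` contains `B`, then `f` centralises `B`. Otherwise `E_f ⊓ B` is
trivial, and it contains the commutators of `f` with the elements of `B` near the identity. So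
`B` is discrete, a contradiction (`inf_centralizer_eq_bot`).

Finally, a virtually soluble locally normal subgroup has an open subgroup that lies in the closure
of a soluble group, and closed derived subgroups reduce to the abelian case
(`IsLocallyNormal.eq_bot_of_isVirtuallySoluble`).
-/

open Filter Topology Set
open scoped commutatorElement

namespace TDLC

variable {G : Type*} [Group G] [TopologicalSpace G]

/-! ### Compact open subgroups -/

section Basics

theorem eventually_mem_of_isOpen {H : Subgroup G} (hH : IsOpen (H : Set G)) :
    ∀ᶠ x in 𝓝 (1 : G), x ∈ H :=
  hH.mem_nhds H.one_mem

variable [IsTopologicalGroup G]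

theorem tendsto_conj_one (g : G) : Tendsto (fun x : G => g * x * g⁻¹) (𝓝 1) (𝓝 1) := by
  have h : Continuous fun x : G => g * x * g⁻¹ := by fun_prop
  simpa using h.tendsto 1

theorem tendsto_commutator_one (g : G) :
    Tendsto (fun x : G => x * g * x⁻¹ * g⁻¹) (𝓝 1) (𝓝 1) := by
  have h : Continuous fun x : G => x * g * x⁻¹ * g⁻¹ := by fun_prop
  simpa using h.tendsto 1

theorem isOpen_of_eventually_mem {H : Subgroup G} (hH : ∀ᶠ x in 𝓝 (1 : G), x ∈ H) :
    IsOpen (H : Set G) :=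
  H.isOpen_of_mem_nhds (g := 1) hH

theorem t2Space_of_totallyDisconnected [TotallyDisconnectedSpace G] : T2Space G := by
  have : T1Space G := ⟨fun x => by
    have h : (closure {x}).Subsingleton := isPreconnected_singleton.closure.subsingleton
    rw [← h.eq_singleton_of_mem (subset_closure rfl)]
    exact isClosed_closure⟩
  infer_instance

/-- **Van Dantzig's theorem**: the left stabiliser of a compact open neighbourhood of the identity
is a compact open subgroup contained in it. -/
theorem exists_compact_open_subgroup [LocallyCompactSpace G] [TotallyDisconnectedSpace G]
    {W : Set G} (hW : W ∈ 𝓝 (1 : G)) :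
    ∃ U : Subgroup G, IsOpen (U : Set G) ∧ IsCompact (U : Set G) ∧ (U : Set G) ⊆ W := by
  have := t2Space_of_totallyDisconnected (G := G)
  obtain ⟨K, hK, hKW, hKc⟩ := local_compact_nhds hW
  obtain ⟨C, hC, h1C, hCK⟩ :=
    (loc_compact_Haus_tot_disc_of_zero_dim (H := G)).mem_nhds_iff.1 hK
  have hCc : IsCompact C := hKc.of_isClosed_subset hC.isClosed hCK
  let U : Subgroup G :=
    { carrier := {x | ∀ y ∈ C, x * y ∈ C ∧ x⁻¹ * y ∈ C}
      one_mem' := fun y hy => by simpa using hy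
      mul_mem' := fun {a b} ha hb y hy => by
        refine ⟨?_, ?_⟩
        · rw [mul_assoc]; exact (ha _ (hb y hy).1).1
        · rw [mul_inv_rev, mul_assoc]; exact (hb _ (ha y hy).2).2
      inv_mem' := fun {a} ha y hy => by
        rw [inv_inv]; exact (ha y hy).symm }
  have hUC : (U : Set G) ⊆ C := fun x hx => by simpa using (hx 1 h1C).1
  have hUo : IsOpen (U : Set G) := by
    apply isOpen_of_eventually_mem
    refine hCc.eventually_forall_of_forall_eventually fun y hy => ?_
    have h1 : Continuous fun z : G × G => z.1 * z.2 := by fun_prop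
    have h2 : Continuous fun z : G × G => z.1⁻¹ * z.2 := by fun_prop
    have hy' : C ∈ 𝓝 y := hC.isOpen.mem_nhds hy
    have e1 : ∀ᶠ z : G × G in 𝓝 (1, y), z.1 * z.2 ∈ C :=
      (h1.tendsto' (1, y) y (one_mul y)).eventually hy'
    have e2 : ∀ᶠ z : G × G in 𝓝 (1, y), z.1⁻¹ * z.2 ∈ C :=
      (h2.tendsto' (1, y) y (by simp)).eventually hy'
    exact e1.and e2
  exact ⟨U, hUo, hCc.of_isClosed_subset (U.isClosed_of_isOpen hUo) hUC,
    hUC.trans (hCK.trans hKW)⟩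

end Basics

/-! ### Local stabilisers -/

section LocalStabilizer

variable [IsTopologicalGroup G]

/-- The subgroup of those elements `g` for which `E` and `g⁻¹ * E * g` coincide near the identity.
For compact `E` in a Hausdorff group this is the commensurator of `E`; the formulation by neighbourhoods avoids
counting cosets. -/
def localStabilizer (E : Subgroup G) : Subgroup G where
  carrier := {g | ∀ᶠ x in 𝓝 (1 : G), x ∈ E ↔ g * x * g⁻¹ ∈ E}
  one_mem' := by simp
  mul_mem' := by
    intro a b ha hb
    filter_upwards [hb, (tendsto_conj_one b).eventually ha] with x h1 h2
    rw [h1, h2]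
    simp only [mul_inv_rev, mul_assoc]
  inv_mem' := by
    intro a ha
    filter_upwards [(tendsto_conj_one a⁻¹).eventually ha] with x h1
    rw [h1]
    simp [mul_assoc]

theorem mem_localStabilizer {E : Subgroup G} {g : G} :
    g ∈ localStabilizer E ↔ ∀ᶠ x in 𝓝 (1 : G), x ∈ E ↔ g * x * g⁻¹ ∈ E :=
  Iff.rfl

theorem normalizer_le_localStabilizer (E : Subgroup G) :
    Subgroup.normalizer (E : Set G) ≤ localStabilizer E := fun _ hg =>
  Eventually.of_forall fun x => Subgroup.mem_normalizer_iff.1 hg x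

theorem localStabilizer_eq_top_of_isOpen {E : Subgroup G} (hE : IsOpen (E : Set G)) :
    localStabilizer E = ⊤ := by
  refine eq_top_iff.2 fun g _ => ?_
  filter_upwards [eventually_mem_of_isOpen hE,
    (tendsto_conj_one g).eventually (eventually_mem_of_isOpen hE)] with x h1 h2
  exact ⟨fun _ => h2, fun _ => h1⟩

theorem localStabilizer_inf (E F : Subgroup G) :
    localStabilizer E ⊓ localStabilizer F ≤ localStabilizer (E ⊓ F) := fun g hg => by
  filter_upwards [mem_localStabilizer.1 hg.1, mem_localStabilizer.1 hg.2] with x h1 h2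
  rw [Subgroup.mem_inf, Subgroup.mem_inf, h1, h2]

theorem localStabilizer_inf_eq_top {E F : Subgroup G} (hE : localStabilizer E = ⊤)
    (hF : localStabilizer F = ⊤) : localStabilizer (E ⊓ F) = ⊤ :=
  top_le_iff.1 ((le_inf hE.ge hF.ge).trans (localStabilizer_inf E F))

theorem isOpen_normalizer_inf {E F : Subgroup G}
    (hE : IsOpen (Subgroup.normalizer (E : Set G) : Set G))
    (hF : IsOpen (Subgroup.normalizer (F : Set G) : Set G)) :
    IsOpen (Subgroup.normalizer ((E ⊓ F : Subgroup G) : Set G) : Set G) :=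
  Subgroup.isOpen_mono (H₁ := Subgroup.normalizer (E : Set G) ⊓ Subgroup.normalizer (F : Set G))
    Subgroup.inf_normalizer_le_normalizer_inf (hE.inter hF)

theorem isOpen_normalizer_of_isOpen {U : Subgroup G} (hU : IsOpen (U : Set G)) :
    IsOpen (Subgroup.normalizer (U : Set G) : Set G) :=
  Subgroup.isOpen_mono Subgroup.le_normalizer hU

/-- If a compact subgroup `U` locally stabilises `B`, and the normaliser of `B` is open, then the
intersection of the `U`-conjugates of `B` still agrees with `B` near the identity: on each coset
of the normaliser the conjugates are constant, and `U` meets only finitely many cosets. -/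
theorem exists_normalized_le {U B : Subgroup G} (hU : IsCompact (U : Set G))
    (hB : IsOpen (Subgroup.normalizer (B : Set G) : Set G)) (hUB : U ≤ localStabilizer B) :
    ∃ B' : Subgroup G, B' ≤ B ∧ U ≤ Subgroup.normalizer (B' : Set G) ∧
      (IsClosed (B : Set G) → IsClosed (B' : Set G)) ∧ ∀ᶠ x in 𝓝 (1 : G), x ∈ B → x ∈ B' := by
  let B' : Subgroup G := ⨅ u : U, B.comap (MulAut.conj (u : G)).toMonoidHom
  have hmem : ∀ x, x ∈ B' ↔ ∀ u ∈ U, u * x * u⁻¹ ∈ B := fun x => by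
    simp [B', Subgroup.mem_iInf]
  refine ⟨B', fun x hx => by simpa using (hmem x).1 hx 1 U.one_mem, ?_, fun hc => ?_, ?_⟩
  · rw [Subgroup.le_normalizer_iff]
    intro u hu x hx
    rw [hmem] at hx ⊢
    intro v hv
    have := hx (v * u) (U.mul_mem hv hu)
    simpa [mul_assoc] using this
  · have : (B' : Set G) = ⋂ u ∈ U, (fun x : G => u * x * u⁻¹) ⁻¹' (B : Set G) := by
      ext x
      simp [hmem]
    rw [this]
    exact isClosed_biInter fun u _ => hc.preimage (by fun_prop)
  · have key : ∀ᶠ x in 𝓝 (1 : G), ∀ u ∈ (U : Set G), x ∈ B → u * x * u⁻¹ ∈ B := by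
      refine hU.eventually_forall_of_forall_eventually fun u hu => ?_
      have h1 : ∀ᶠ v in 𝓝 u, v * u⁻¹ ∈ Subgroup.normalizer (B : Set G) := by
        have hc : Continuous fun v : G => v * u⁻¹ := by fun_prop
        exact hc.tendsto u (hB.mem_nhds (by simp))
      rw [nhds_prod_eq]
      filter_upwards [(mem_localStabilizer.1 (hUB hu)).prod_mk h1] with z hz hzB
      have := (Subgroup.mem_normalizer_iff.1 hz.2 _).1 (hz.1.1 hzB)
      simpa [mul_assoc] using this
    filter_upwards [key] with x hx hxB
    exact (hmem x).2 fun u hu => hx u hu hxB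

end LocalStabilizer

/-! ### Topological automorphisms -/

section Automorphisms

theorem mem_map_continuousMulEquiv {φ : G ≃ₜ* G} {H : Subgroup G} {x : G} :
    x ∈ H.map (φ.toMulEquiv : G →* G) ↔ φ.symm x ∈ H := by
  constructor
  · rintro ⟨y, hy, rfl⟩
    have : φ.symm (φ y) = y := φ.symm_apply_apply y
    exact this.symm ▸ hy
  · intro h
    exact ⟨φ.symm x, h, φ.apply_symm_apply x⟩

theorem IsLocallyNormal.map {K : Subgroup G} (hK : IsLocallyNormal K) (φ : G ≃ₜ* G) :
    IsLocallyNormal (K.map (φ.toMulEquiv : G →* G)) := by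
  have hmem : ∀ (H : Subgroup G),
      ((H.map (φ.toMulEquiv : G →* G) : Subgroup G) : Set G) = φ '' H := fun H => rfl
  refine ⟨?_, ?_⟩
  · rw [hmem]
    exact hK.1.image φ.continuous
  · have h : Subgroup.normalizer ((K.map (φ.toMulEquiv : G →* G) : Subgroup G) : Set G) =
        (Subgroup.normalizer (K : Set G)).map (φ.toMulEquiv : G →* G) := by
      ext x
      rw [mem_map_continuousMulEquiv, Subgroup.mem_normalizer_iff, Subgroup.mem_normalizer_iff]
      constructor
      · intro hx y
        have := hx (φ y)
        simpa only [mem_map_continuousMulEquiv, map_mul, map_inv, φ.symm_apply_apply] using this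
      · intro hx y
        simpa only [mem_map_continuousMulEquiv, map_mul, map_inv] using hx (φ.symm y)
    rw [h, hmem]
    exact φ.toHomeomorph.isOpenMap _ hK.2

theorem map_ne_bot {K : Subgroup G} (hK : K ≠ ⊥) (φ : G ≃ₜ* G) :
    K.map (φ.toMulEquiv : G →* G) ≠ ⊥ := by
  rwa [Ne, Subgroup.map_eq_bot_iff_of_injective _ φ.injective]

variable [IsTopologicalGroup G]

theorem localStabilizer_map {E : Subgroup G} (hE : localStabilizer E = ⊤) (φ : G ≃ₜ* G) :
    localStabilizer (E.map (φ.toMulEquiv : G →* G)) = ⊤ := by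
  refine eq_top_iff.2 fun g _ => ?_
  have h : φ.symm g ∈ localStabilizer E := hE ▸ Subgroup.mem_top _
  have ht : Tendsto φ.symm (𝓝 1) (𝓝 1) := φ.symm.continuous.tendsto' 1 1 (map_one φ.symm)
  filter_upwards [ht.eventually (mem_localStabilizer.1 h)] with x hx
  simpa only [mem_map_continuousMulEquiv, map_mul, map_inv] using hx

/-- Conjugation by an element, as an automorphism of the topological group. -/
def conjEquiv (g : G) : G ≃ₜ* G where
  toMulEquiv := MulAut.conj g
  continuous_toFun := by
    change Continuous fun x : G => g * x * g⁻¹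
    fun_prop
  continuous_invFun := by
    change Continuous fun x : G => g⁻¹ * x * g
    fun_prop

theorem mem_map_conjEquiv {g x : G} {H : Subgroup G} :
    x ∈ H.map ((conjEquiv g).toMulEquiv : G →* G) ↔ g⁻¹ * x * g ∈ H :=
  mem_map_continuousMulEquiv

end Automorphisms

/-! ### Generation by invariant subsets -/

section Generation

variable [IsTopologicalGroup G]

/-- In a compactly generated group, a dense subgroup supplies finitely many elements which
together with a given open subgroup generate everything. -/
theorem exists_finset_closure_eq_top (hcg : IsCompactlyGeneratedGroup G) {S : Set G}
    (hS : (Subgroup.closure S).topologicalClosure = ⊤) {U : Subgroup G}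
    (hU : IsOpen (U : Set G)) :
    ∃ F : Finset G, (F : Set G) ⊆ S ∧ Subgroup.closure ((U : Set G) ∪ F) = ⊤ := by
  classical
  obtain ⟨C, hC, hCtop⟩ := hcg
  let H : {F : Finset G // (F : Set G) ⊆ S} → Subgroup G :=
    fun F => Subgroup.closure ((U : Set G) ∪ F.1)
  have hUH : ∀ F, U ≤ H F := fun F x hx => Subgroup.subset_closure (Or.inl hx)
  have hHo : ∀ F, IsOpen (H F : Set G) := fun F => Subgroup.isOpen_mono (hUH F) hU
  have hmono : ∀ F F' : {F : Finset G // (F : Set G) ⊆ S}, F.1 ⊆ F'.1 → H F ≤ H F' :=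
    fun F F' h => Subgroup.closure_mono (union_subset_union_right _ (by exact_mod_cast h))
  have hdir : Directed (· ≤ ·) H := fun F F' =>
    ⟨⟨F.1 ∪ F'.1, by simpa using ⟨F.2, F'.2⟩⟩,
      hmono _ _ Finset.subset_union_left, hmono _ _ Finset.subset_union_right⟩
  have : Nonempty {F : Finset G // (F : Set G) ⊆ S} := ⟨⟨∅, by simp⟩⟩
  have hsup : ⨆ F, H F = ⊤ := by
    have hcl : IsClosed ((⨆ F, H F : Subgroup G) : Set G) :=
      Subgroup.isClosed_of_isOpen _
        (Subgroup.isOpen_mono (le_iSup H (Classical.arbitrary _)) (hHo _))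
    refine top_le_iff.1 (hS.ge.trans (Subgroup.topologicalClosure_minimal _ ?_ hcl))
    rw [Subgroup.closure_le]
    intro s hs
    exact (le_iSup H ⟨{s}, by simpa using hs⟩) (Subgroup.subset_closure (by simp))
  obtain ⟨F, hF⟩ := hC.elim_directed_cover (fun F => (H F : Set G)) hHo (fun x _ => by
    have hx : x ∈ ⨆ F, H F := hsup ▸ Subgroup.mem_top x
    rw [Subgroup.mem_iSup_of_directed hdir] at hx
    simpa using hx) (fun F F' => by
      obtain ⟨F'', h1, h2⟩ := hdir F F'
      exact ⟨F'', h1, h2⟩)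
  refine ⟨F.1, F.2, top_le_iff.1 ?_⟩
  rw [← hCtop, Subgroup.closure_le]
  exact hF

/-- In a topologically characteristically simple group, a nontrivial subset which is stable under
all automorphisms generates a dense subgroup. -/
theorem IsTopCharSimple.topologicalClosure_eq_top [T2Space G] (hsimple : IsTopCharSimple G)
    {S : Set G} (hS : ∀ φ : G ≃ₜ* G, ∀ s ∈ S, φ s ∈ S) {s : G} (hs : s ∈ S) (hs1 : s ≠ 1) :
    (Subgroup.closure S).topologicalClosure = ⊤ := by
  set D := (Subgroup.closure S).topologicalClosure with hD
  have hDc : IsClosed (D : Set G) := Subgroup.isClosed_topologicalClosure _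
  have hle : ∀ φ : G ≃ₜ* G, D ≤ D.comap (φ.toMulEquiv : G →* G) := fun φ => by
    refine Subgroup.topologicalClosure_minimal _ ?_ (hDc.preimage φ.continuous)
    rw [Subgroup.closure_le]
    intro t ht
    exact Subgroup.le_topologicalClosure _ (Subgroup.subset_closure (hS φ t ht))
  refine (hsimple D hDc fun φ => ?_).resolve_left fun h => hs1 ?_
  · refine le_antisymm (Subgroup.map_le_iff_le_comap.2 (hle φ)) fun x hx => ?_
    rw [mem_map_continuousMulEquiv]
    exact hle φ.symm hx
  · have : s ∈ D := Subgroup.le_topologicalClosure _ (Subgroup.subset_closure hs)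
    simpa [h] using this

/-- A compactly generated, noncompact, topologically characteristically simple group has no
nontrivial compact normal subgroup: otherwise finitely many such subgroups would, together with a
compact open subgroup, generate the group, which would then be a product of compact sets. -/
theorem eq_bot_of_isCompact_of_normal [T2Space G] (hcg : IsCompactlyGeneratedGroup G)
    (hsimple : IsTopCharSimple G) (hcompact : ¬ CompactSpace G) {U : Subgroup G}
    (hUo : IsOpen (U : Set G)) (hUc : IsCompact (U : Set G)) {N : Subgroup G}
    (hN : IsCompact (N : Set G)) (hNn : N.Normal) : N = ⊥ := by
  classical
  by_contra hne
  obtain ⟨x, hx, hx1⟩ := N.bot_or_exists_ne_one.resolve_left hne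
  let S : Set G := {y | ∃ M : Subgroup G, IsCompact (M : Set G) ∧ M.Normal ∧ y ∈ M}
  have hS : ∀ φ : G ≃ₜ* G, ∀ s ∈ S, φ s ∈ S := by
    rintro φ s ⟨M, hM, hMn, hs⟩
    exact ⟨M.map (φ.toMulEquiv : G →* G), hM.image φ.continuous,
      hMn.map _ φ.surjective, s, hs, rfl⟩
  obtain ⟨F, hFS, hF⟩ := exists_finset_closure_eq_top hcg
    (hsimple.topologicalClosure_eq_top hS ⟨N, hN, hNn, hx⟩ hx1) hUo
  have key : ∀ F : Finset G, (F : Set G) ⊆ S →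
      ∃ M : Subgroup G, IsCompact (M : Set G) ∧ M.Normal ∧ (F : Set G) ⊆ M := by
    intro F
    induction F using Finset.induction_on with
    | empty => exact fun _ => ⟨N, hN, hNn, by simp⟩
    | insert a F _ ih =>
      intro h
      rw [Finset.coe_insert, insert_subset_iff] at h
      obtain ⟨M, hM, hMn, hFM⟩ := ih h.2
      obtain ⟨M', hM', hMn', ha⟩ := h.1
      refine ⟨M ⊔ M', ?_, inferInstance, ?_⟩
      · rw [Subgroup.mul_normal]
        exact hM.mul hM'
      · rw [Finset.coe_insert, insert_subset_iff]
        exact ⟨(le_sup_right : M' ≤ M ⊔ M') ha, hFM.trans (le_sup_left : M ≤ M ⊔ M')⟩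
  obtain ⟨M, hM, hMn, hFM⟩ := key F hFS
  have htop : U ⊔ M = ⊤ := by
    rw [← top_le_iff, ← hF, Subgroup.closure_le]
    exact union_subset (le_sup_left : U ≤ U ⊔ M) (hFM.trans (le_sup_right : M ≤ U ⊔ M))
  refine hcompact ⟨?_⟩
  rw [← Subgroup.coe_top (G := G), ← htop, Subgroup.mul_normal]
  exact hUc.mul hM

/-- If `G` is generated by a compact open subgroup and finitely many elements, each of which
centralises `B` near the identity, then the intersection of the conjugates of a small open subgroup
of `B` is normal in `G`, hence trivial when `G` has no nontrivial compact normal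
subgroup; so `B` is discrete. -/
theorem eventually_mem_eq_one [LocallyCompactSpace G] [TotallyDisconnectedSpace G] [T2Space G]
    (hnormal : ∀ N : Subgroup G, IsCompact (N : Set G) → N.Normal → N = ⊥)
    {U : Subgroup G} (hUc : IsCompact (U : Set G)) {F : Finset G}
    (hF : Subgroup.closure ((U : Set G) ∪ F) = ⊤) {B : Subgroup G} (hB : IsLocallyNormal B)
    (hstab : localStabilizer B = ⊤)
    (hcomm : ∀ f ∈ F, ∀ᶠ x in 𝓝 (1 : G), x ∈ B → f * x = x * f) :
    ∀ᶠ x in 𝓝 (1 : G), x ∈ B → x = 1 := by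
  have hev : ∀ᶠ x in 𝓝 (1 : G), ∀ f ∈ F, x ∈ B → f * x = x * f :=
    (Finset.eventually_all F).2 hcomm
  obtain ⟨W, hWo, hWc, hW⟩ := exists_compact_open_subgroup hev
  obtain ⟨B', hB'le, hUB', hcl, hB'⟩ := exists_normalized_le (B := B ⊓ W) hUc
    (isOpen_normalizer_inf hB.2 (isOpen_normalizer_of_isOpen hWo))
    (by rw [localStabilizer_inf_eq_top hstab (localStabilizer_eq_top_of_isOpen hWo)]
        exact le_top)
  have hB'c : IsCompact (B' : Set G) :=
    hWc.of_isClosed_subset (hcl (hB.1.isClosed.inter hWc.isClosed)) fun x hx => (hB'le hx).2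
  have hB'n : B'.Normal := by
    rw [← Subgroup.normalizer_eq_top_iff, ← top_le_iff, ← hF, Subgroup.closure_le]
    refine union_subset hUB' fun f hf => ?_
    refine (Subgroup.centralizer_le_normalizer (B' : Set G)) ?_
    rw [Subgroup.mem_centralizer_iff]
    intro x hx
    exact (hW (hB'le hx).2 f hf (hB'le hx).1).symm
  have hbot := hnormal B' hB'c hB'n
  filter_upwards [hB', eventually_mem_of_isOpen hWo] with x hx hxW hxB
  simpa [hbot] using hx ⟨hxB, hxW⟩

end Generation

/-! ### The quasi-centre -/

section QuasiCentre

variable [IsTopologicalGroup G]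

theorem map_mem_quasiCentre (φ : G ≃ₜ* G) {g : G} (hg : g ∈ quasiCentre G) :
    φ g ∈ quasiCentre G := by
  have h : ((Subgroup.centralizer ({φ g} : Set G) : Subgroup G) : Set G) =
      φ.symm ⁻¹' (Subgroup.centralizer ({g} : Set G) : Set G) := by
    ext x
    simp only [SetLike.mem_coe, Subgroup.mem_centralizer_singleton_iff, mem_preimage]
    rw [← φ.injective.eq_iff (a := φ.symm x * g), map_mul, map_mul, φ.apply_symm_apply]
  change IsOpen _
  rw [h]
  exact IsOpen.preimage φ.symm.continuous hg

/-- A discrete subgroup with open normaliser lies in the quasi-centre: commutators of its elements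
with elements close to the identity are close to the identity and stay in the subgroup. -/
theorem eq_bot_of_eventually_mem_eq_one (hQZ : quasiCentre G = ⊥) {B : Subgroup G}
    (hB : IsOpen (Subgroup.normalizer (B : Set G) : Set G))
    (h1 : ∀ᶠ x in 𝓝 (1 : G), x ∈ B → x = 1) : B = ⊥ := by
  rw [eq_bot_iff, ← hQZ]
  intro b hb
  apply isOpen_of_eventually_mem
  filter_upwards [eventually_mem_of_isOpen hB, (tendsto_commutator_one b).eventually h1]
    with x hx hxb
  have := hxb (B.mul_mem ((Subgroup.mem_normalizer_iff.1 hx b).1 hb) (B.inv_mem hb))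
  rw [Subgroup.mem_centralizer_singleton_iff]
  exact mul_inv_eq_iff_eq_mul.1 (mul_inv_eq_one.1 this)

theorem quasiCentre_eq_bot [LocallyCompactSpace G] [TotallyDisconnectedSpace G] [T2Space G]
    (hcg : IsCompactlyGeneratedGroup G) (hsimple : IsTopCharSimple G)
    (hdiscrete : ¬ DiscreteTopology G)
    (hnormal : ∀ N : Subgroup G, IsCompact (N : Set G) → N.Normal → N = ⊥) :
    quasiCentre G = ⊥ := by
  by_contra hne
  obtain ⟨x, hx, hx1⟩ := (Subgroup.bot_or_exists_ne_one _).resolve_left hne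
  obtain ⟨U, hUo, hUc, -⟩ := exists_compact_open_subgroup (G := G) univ_mem
  obtain ⟨F, hFS, hF⟩ := exists_finset_closure_eq_top hcg
    (hsimple.topologicalClosure_eq_top (S := (quasiCentre G : Set G))
      (fun φ _ hs => map_mem_quasiCentre φ hs) hx hx1) hUo
  have := eventually_mem_eq_one hnormal hUc hF ⟨hUc, isOpen_normalizer_of_isOpen hUo⟩
    (localStabilizer_eq_top_of_isOpen hUo) fun f hf => by
      filter_upwards [eventually_mem_of_isOpen (hFS hf)] with x hx _
      exact (Subgroup.mem_centralizer_singleton_iff.1 hx).symm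
  refine hdiscrete (discreteTopology_of_isOpen_singleton_one ?_)
  rw [← Subgroup.coe_bot]
  apply isOpen_of_eventually_mem
  filter_upwards [this, eventually_mem_of_isOpen hUo] with x hx hxU
  exact hx hxU

end QuasiCentre

/-! ### Maximal nontrivial intersections -/

section Intersections

/-- Intersecting as many members of a finite family of nontrivial subgroups as possible without
reaching the trivial group gives a subgroup which meets every other member trivially. -/
theorem exists_maximal_inf_ne_bot {G : Type*} [Group G] {𝓐 : Finset (Subgroup G)}
    (hne : 𝓐.Nonempty) (hbot : ∀ A ∈ 𝓐, A ≠ ⊥) :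
    ∃ J ⊆ 𝓐, J.Nonempty ∧ J.inf id ≠ ⊥ ∧ ∀ A ∈ 𝓐, A ∈ J ∨ A ⊓ J.inf id = ⊥ := by
  classical
  obtain ⟨A₀, hA₀⟩ := hne
  obtain ⟨J, hJ, hmax⟩ := Finset.exists_max_image
    (𝓐.powerset.filter fun J => J.Nonempty ∧ J.inf id ≠ ⊥) Finset.card
    ⟨{A₀}, by simpa [hA₀] using hbot A₀ hA₀⟩
  simp only [Finset.mem_filter, Finset.mem_powerset] at hJ hmax
  refine ⟨J, hJ.1, hJ.2.1, hJ.2.2, fun A hA => or_iff_not_imp_left.2 fun hAJ => ?_⟩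
  by_contra h
  have := hmax (insert A J) ⟨Finset.insert_subset hA hJ.1, Finset.insert_nonempty _ _, by
    rwa [Finset.inf_insert]⟩
  rw [Finset.card_insert_of_notMem hAJ] at this
  lia

theorem mem_finset_inf_id {G : Type*} [Group G] {J : Finset (Subgroup G)} {x : G} :
    x ∈ J.inf id ↔ ∀ A ∈ J, x ∈ A := by
  rw [Finset.inf_eq_iInf]
  simp [Subgroup.mem_iInf]

/-- Finitely many nontrivial abelian subgroups which normalise each other generate a group with
nontrivial centre: a maximal nontrivial intersection lies in each member that takes part in it,
and commutes with the others because it is normalised by them and meets them trivially. -/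
theorem iSup_inf_centralizer_ne_bot {G : Type*} [Group G] {𝓐 : Finset (Subgroup G)}
    (hne : 𝓐.Nonempty) (hbot : ∀ A ∈ 𝓐, A ≠ ⊥)
    (hab : ∀ A ∈ 𝓐, ∀ x ∈ A, ∀ y ∈ A, x * y = y * x)
    (hnorm : ∀ A ∈ 𝓐, ∀ A' ∈ 𝓐, A ≤ Subgroup.normalizer (A' : Set G)) :
    (⨆ A ∈ 𝓐, A) ⊓ Subgroup.centralizer ((⨆ A ∈ 𝓐, A : Subgroup G) : Set G) ≠ ⊥ := by
  obtain ⟨J, hJ𝓐, ⟨A₀, hA₀⟩, hJ, hmax⟩ := exists_maximal_inf_ne_bot hne hbot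
  refine ne_bot_of_le_ne_bot hJ (le_inf ?_ ?_)
  · exact (Finset.inf_le hA₀).trans (le_iSup₂_of_le A₀ (hJ𝓐 hA₀) le_rfl)
  · rw [Subgroup.le_centralizer_iff]
    refine iSup₂_le fun A hA a ha => ?_
    rw [Subgroup.mem_centralizer_iff]
    intro b hb
    rcases hmax A hA with hAJ | hAJ
    · exact hab A hA b (mem_finset_inf_id.1 hb A hAJ) a ha
    · have hbA : b * a * b⁻¹ * a⁻¹ ∈ A := by
        have hbN := hnorm A₀ (hJ𝓐 hA₀) A hA (mem_finset_inf_id.1 hb A₀ hA₀)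
        exact A.mul_mem ((Subgroup.mem_normalizer_iff.1 hbN a).1 ha) (A.inv_mem ha)
      have hbB : b * a * b⁻¹ * a⁻¹ ∈ J.inf id := by
        refine mem_finset_inf_id.2 fun A' hA' => ?_
        have hbA' := mem_finset_inf_id.1 hb A' hA'
        have haN := hnorm A hA A' (hJ𝓐 hA') ha
        have := A'.mul_mem hbA' ((Subgroup.mem_normalizer_iff.1 haN _).1 (A'.inv_mem hbA'))
        simpa [mul_assoc] using this
      have h1 : b * a * b⁻¹ * a⁻¹ ∈ A ⊓ J.inf id := ⟨hbA, hbB⟩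
      rw [hAJ, Subgroup.mem_bot] at h1
      exact mul_inv_eq_iff_eq_mul.1 (mul_inv_eq_one.1 h1)

end Intersections

variable [IsTopologicalGroup G]

theorem inf_centralizer_topologicalClosure_ne_bot [T2Space G] {H : Subgroup G}
    (hH : H ⊓ Subgroup.centralizer (H : Set G) ≠ ⊥) :
    H.topologicalClosure ⊓ Subgroup.centralizer (H.topologicalClosure : Set G) ≠ ⊥ := by
  refine ne_bot_of_le_ne_bot hH (le_inf (inf_le_left.trans H.le_topologicalClosure) ?_)
  rw [Subgroup.le_centralizer_iff]
  refine Subgroup.topologicalClosure_minimal _ ?_ (Set.isClosed_centralizer _)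
  rw [Subgroup.le_centralizer_iff]
  exact inf_le_right

/-- A subgroup with open normaliser has only finitely many conjugates under a compact group. -/
theorem finite_range_conj {U A : Subgroup G} (hU : IsCompact (U : Set G))
    (hA : IsOpen (Subgroup.normalizer (A : Set G) : Set G)) :
    (range fun u : U => A.map ((conjEquiv (u : G)).toMulEquiv : G →* G)).Finite := by
  have : CompactSpace U := isCompact_iff_compactSpace.1 hU
  refine IsLocallyConstant.range_finite ((IsLocallyConstant.iff_eventually_eq _).2 fun u => ?_)
  have hc : Continuous fun v : U => (v : G)⁻¹ * u := by fun_prop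
  have : ∀ᶠ v : U in 𝓝 u, (v : G)⁻¹ * u ∈ Subgroup.normalizer (A : Set G) :=
    hc.tendsto u (hA.mem_nhds (by simp))
  filter_upwards [this] with v hv
  ext x
  rw [mem_map_conjEquiv, mem_map_conjEquiv, iff_comm, Subgroup.mem_normalizer_iff.1 hv]
  simp [mul_assoc]

/-! ### Abelian locally normal subgroups -/

/-- A nontrivial abelian locally normal subgroup `A` gives rise to a locally normal subgroup `E`
with nontrivial centre which is locally stabilised by the whole group. Elements `a` of finitely
many images of `A` under automorphisms generate `G` together with a compact open subgroup `U`, and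
`E` is generated by the intersections of the `U`-conjugates of these images with a small normal
open subgroup of `U`. Modulo `E`, each such `a` acts trivially near the identity. -/
theorem exists_localStabilizer_eq_top [LocallyCompactSpace G] [TotallyDisconnectedSpace G]
    [T2Space G] (hcg : IsCompactlyGeneratedGroup G) (hsimple : IsTopCharSimple G)
    (hcompact : ¬ CompactSpace G) (hQZ : quasiCentre G = ⊥) {A : Subgroup G}
    (hA : IsLocallyNormal A) (hab : ∀ x ∈ A, ∀ y ∈ A, x * y = y * x) (hA1 : A ≠ ⊥) :
    ∃ E : Subgroup G, IsLocallyNormal E ∧ localStabilizer E = ⊤ ∧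
      E ⊓ Subgroup.centralizer (E : Set G) ≠ ⊥ := by
  classical
  obtain ⟨x, hx, hx1⟩ := A.bot_or_exists_ne_one.resolve_left hA1
  obtain ⟨U, hUo, hUc, -⟩ := exists_compact_open_subgroup (G := G) univ_mem
  obtain ⟨F, hFS, hF⟩ := exists_finset_closure_eq_top hcg
    (hsimple.topologicalClosure_eq_top (S := {y | ∃ φ : G ≃ₜ* G, φ y ∈ A})
      (fun φ y ⟨ψ, hψ⟩ => ⟨φ.symm.trans ψ, by simpa using hψ⟩)
      ⟨ContinuousMulEquiv.refl G, hx⟩ hx1) hUo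
  have hFne : F.Nonempty := by
    rw [Finset.nonempty_iff_ne_empty]
    rintro rfl
    rw [Finset.coe_empty, union_empty, Subgroup.closure_eq] at hF
    exact hcompact ⟨by simpa [hF] using hUc⟩
  have hFA : ∀ f ∈ F, ∃ φ : G ≃ₜ* G, φ f ∈ A := fun f hf => hFS hf
  choose! φ hφ using hFA
  -- `K f` is the image of `A` containing the generator `f`.
  let K : G → Subgroup G := fun f => A.map ((φ f).symm.toMulEquiv : G →* G)
  have hK : ∀ f, IsLocallyNormal (K f) := fun f => hA.map _
  have hfK : ∀ f ∈ F, f ∈ K f := fun f hf => mem_map_continuousMulEquiv.2 (hφ f hf)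
  have hKab : ∀ f, ∀ y ∈ K f, ∀ z ∈ K f, y * z = z * y := by
    rintro f _ ⟨y, hy, rfl⟩ _ ⟨z, hz, rfl⟩
    rw [← map_mul, hab y hy z hz, map_mul]
  obtain ⟨V, hVU, hVK, hUV, hVo⟩ : ∃ V : Subgroup G, V ≤ U ∧
      (∀ f ∈ F, V ≤ Subgroup.normalizer (K f : Set G)) ∧
      U ≤ Subgroup.normalizer (V : Set G) ∧ IsOpen (V : Set G) := by
    have hev : ∀ᶠ x in 𝓝 (1 : G), x ∈ U ∧ ∀ f ∈ F, x ∈ Subgroup.normalizer (K f : Set G) :=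
      (eventually_mem_of_isOpen hUo).and
        ((Finset.eventually_all F).2 fun f _ => eventually_mem_of_isOpen (hK f).2)
    obtain ⟨W, hWo, -, hW⟩ := exists_compact_open_subgroup hev
    obtain ⟨V, hVW, hUV, -, hV⟩ := exists_normalized_le hUc (isOpen_normalizer_of_isOpen hWo)
      (by rw [localStabilizer_eq_top_of_isOpen hWo]; exact le_top)
    refine ⟨V, fun x hx => (hW (hVW hx)).1, fun f hf x hx => (hW (hVW hx)).2 f hf, hUV,
      isOpen_of_eventually_mem ?_⟩
    filter_upwards [hV, eventually_mem_of_isOpen hWo] with x h1 h2 using h1 h2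
  have hfin : (⋃ f ∈ F, (· ⊓ V) '' range fun u : U =>
      (K f).map ((conjEquiv (u : G)).toMulEquiv : G →* G)).Finite :=
    F.finite_toSet.biUnion fun f _ => (finite_range_conj hUc (hK f).2).image _
  obtain ⟨𝓐, h𝓐⟩ : ∃ 𝓐 : Finset (Subgroup G), ∀ B, B ∈ 𝓐 ↔ ∃ f ∈ F, ∃ u ∈ U,
      (K f).map ((conjEquiv u).toMulEquiv : G →* G) ⊓ V = B :=
    ⟨hfin.toFinset, fun B => by simp⟩
  clear hfin
  have hmem : ∀ f u x, x ∈ (K f).map ((conjEquiv u).toMulEquiv : G →* G) ⊓ V ↔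
      u⁻¹ * x * u ∈ K f ∧ x ∈ V := fun f u x => by
    rw [Subgroup.mem_inf, mem_map_conjEquiv]
  have hVu : ∀ u ∈ U, ∀ v ∈ V, u * v * u⁻¹ ∈ V := Subgroup.le_normalizer_iff.1 hUV
  have hVn : ∀ B ∈ 𝓐, V ≤ Subgroup.normalizer (B : Set G) := by
    intro B hB
    obtain ⟨f, hf, u, hu, rfl⟩ := (h𝓐 B).1 hB
    rw [Subgroup.le_normalizer_iff]
    intro v hv y hy
    rw [hmem] at hy ⊢
    refine ⟨?_, V.mul_mem (V.mul_mem hv hy.2) (V.inv_mem hv)⟩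
    have h1 := hVK f hf (hVu _ (U.inv_mem hu) v hv)
    have h2 := (Subgroup.mem_normalizer_iff.1 h1 _).1 hy.1
    simpa [mul_assoc] using h2
  have hle : ∀ B ∈ 𝓐, B ≤ V := by
    intro B hB
    obtain ⟨f, hf, u, hu, rfl⟩ := (h𝓐 B).1 hB
    exact inf_le_right
  let H : Subgroup G := ⨆ B ∈ 𝓐, B
  have hH : ∀ B ∈ 𝓐, B ≤ H := fun B hB => le_iSup₂_of_le B hB le_rfl
  have hcentre : H ⊓ Subgroup.centralizer (H : Set G) ≠ ⊥ := by
    refine iSup_inf_centralizer_ne_bot ?_ ?_ ?_ fun B hB B' hB' => (hle B hB).trans (hVn B' hB')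
    · obtain ⟨f, hf⟩ := hFne
      exact ⟨_, (h𝓐 _).2 ⟨f, hf, 1, U.one_mem, rfl⟩⟩
    · intro B hB hbot
      obtain ⟨f, hf, u, hu, rfl⟩ := (h𝓐 B).1 hB
      refine map_ne_bot (map_ne_bot hA1 _) (conjEquiv u)
        (eq_bot_of_eventually_mem_eq_one hQZ ((hK f).map _).2 ?_)
      filter_upwards [eventually_mem_of_isOpen hVo] with y hy hyK
      have : y ∈ (K f).map ((conjEquiv u).toMulEquiv : G →* G) ⊓ V := ⟨hyK, hy⟩
      rwa [hbot, Subgroup.mem_bot] at this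
    · intro B hB y hy z hz
      obtain ⟨f, hf, u, hu, rfl⟩ := (h𝓐 B).1 hB
      have := hKab f _ (mem_map_conjEquiv.1 hy.1) _ (mem_map_conjEquiv.1 hz.1)
      exact mul_right_cancel (b := u) (by simpa [mul_assoc] using this)
  have hEU : H.topologicalClosure ≤ U :=
    Subgroup.topologicalClosure_minimal _ (iSup₂_le fun B hB => (hle B hB).trans hVU)
      hUc.isClosed
  have hUE : U ≤ Subgroup.normalizer (H.topologicalClosure : Set G) := by
    rw [Subgroup.le_normalizer_iff]
    intro u hu
    have : H.topologicalClosure ≤ H.topologicalClosure.comap (MulAut.conj u).toMonoidHom := by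
      refine Subgroup.topologicalClosure_minimal _ (iSup₂_le fun B hB y hy => ?_)
        (H.isClosed_topologicalClosure.preimage (f := fun x : G => u * x * u⁻¹) (by fun_prop))
      obtain ⟨f, hf, v, hv, rfl⟩ := (h𝓐 B).1 hB
      rw [hmem] at hy
      refine H.le_topologicalClosure (hH _ ((h𝓐 _).2 ⟨f, hf, u * v, U.mul_mem hu hv, rfl⟩)
        ((hmem _ _ _).2 ⟨?_, hVu u hu y hy.2⟩))
      simpa [mul_assoc] using hy.1
    exact this
  refine ⟨H.topologicalClosure, ⟨hUc.of_isClosed_subset H.isClosed_topologicalClosure hEU,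
    Subgroup.isOpen_mono hUE hUo⟩, ?_, inf_centralizer_topologicalClosure_ne_bot hcentre⟩
  rw [← top_le_iff, ← hF, Subgroup.closure_le]
  refine union_subset (hUE.trans (normalizer_le_localStabilizer _)) fun f hf => ?_
  filter_upwards [eventually_mem_of_isOpen hVo,
    (tendsto_conj_one f).eventually (eventually_mem_of_isOpen hVo)] with y hy hfy
  -- `y` normalises `K f`, so the commutator of `f` and `y` lies in `K f ⊓ V ≤ E`.
  have hcomm : f * y * f⁻¹ * y⁻¹ ∈ H.topologicalClosure := by
    refine H.le_topologicalClosure (hH _ ((h𝓐 _).2 ⟨f, hf, 1, U.one_mem, rfl⟩)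
      ((hmem _ _ _).2 ⟨?_, V.mul_mem hfy (V.inv_mem hy)⟩))
    have := (K f).mul_mem (hfK f hf)
      ((Subgroup.mem_normalizer_iff.1 (hVK f hf hy) _).1 ((K f).inv_mem (hfK f hf)))
    simpa [mul_assoc] using this
  constructor
  · intro h
    simpa using H.topologicalClosure.mul_mem hcomm h
  · intro h
    simpa [mul_assoc] using
      H.topologicalClosure.mul_mem (H.topologicalClosure.inv_mem hcomm) h

/-- A locally normal subgroup which is locally stabilised by the whole group has trivial centre.
Otherwise, finitely many elements lying in the centres of images `E f` of `E` under automorphisms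
generate `G` together with a compact open subgroup. All of them centralise a maximal nontrivial
intersection of the `E f` near the identity. -/
theorem inf_centralizer_eq_bot [LocallyCompactSpace G] [TotallyDisconnectedSpace G]
    [T2Space G] (hcg : IsCompactlyGeneratedGroup G) (hsimple : IsTopCharSimple G)
    (hcompact : ¬ CompactSpace G) (hQZ : quasiCentre G = ⊥)
    (hnormal : ∀ N : Subgroup G, IsCompact (N : Set G) → N.Normal → N = ⊥) {E : Subgroup G}
    (hE : IsLocallyNormal E) (hstab : localStabilizer E = ⊤) :
    E ⊓ Subgroup.centralizer (E : Set G) = ⊥ := by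
  classical
  by_contra hne
  obtain ⟨x, hx, hx1⟩ := Subgroup.bot_or_exists_ne_one _ |>.resolve_left hne
  obtain ⟨U, hUo, hUc, -⟩ := exists_compact_open_subgroup (G := G) univ_mem
  obtain ⟨F, hFS, hF⟩ := exists_finset_closure_eq_top hcg
    (hsimple.topologicalClosure_eq_top
      (S := {y | ∃ φ : G ≃ₜ* G, φ y ∈ E ⊓ Subgroup.centralizer (E : Set G)})
      (fun φ y ⟨ψ, hψ⟩ => ⟨φ.symm.trans ψ, by simpa using hψ⟩)
      ⟨ContinuousMulEquiv.refl G, hx⟩ hx1) hUo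
  have hFne : F.Nonempty := by
    rw [Finset.nonempty_iff_ne_empty]
    rintro rfl
    rw [Finset.coe_empty, union_empty, Subgroup.closure_eq] at hF
    exact hcompact ⟨by simpa [hF] using hUc⟩
  have hFE : ∀ f ∈ F, ∃ φ : G ≃ₜ* G, φ f ∈ E ⊓ Subgroup.centralizer (E : Set G) :=
    fun f hf => hFS hf
  choose! φ hφ using hFE
  let K : G → Subgroup G := fun f => E.map ((φ f).symm.toMulEquiv : G →* G)
  have hK : ∀ f, IsLocallyNormal (K f) := fun f => hE.map _
  have hfK : ∀ f ∈ F, f ∈ K f := fun f hf => mem_map_continuousMulEquiv.2 (hφ f hf).1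
  have hfc : ∀ f ∈ F, ∀ y ∈ K f, f * y = y * f := fun f hf y hy => by
    have := Subgroup.mem_centralizer_iff.1 (hφ f hf).2 _ (mem_map_continuousMulEquiv.1 hy)
    refine (φ f).injective ?_
    rw [map_mul, map_mul]
    exact this.symm
  obtain ⟨J, hJ𝓐, hJne, hJ, hmax⟩ := exists_maximal_inf_ne_bot (𝓐 := F.image K)
    (hFne.image K) (by
      intro B hB
      obtain ⟨f, hf, rfl⟩ := Finset.mem_image.1 hB
      exact map_ne_bot (ne_bot_of_le_ne_bot hne inf_le_left) _)
  have hJall : ∀ B ∈ J, IsLocallyNormal B ∧ localStabilizer B = ⊤ := by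
    intro B hB
    obtain ⟨f, hf, rfl⟩ := Finset.mem_image.1 (hJ𝓐 hB)
    exact ⟨hK f, localStabilizer_map hstab _⟩
  have hBn : IsLocallyNormal (J.inf id) ∧ localStabilizer (J.inf id) = ⊤ := by
    clear hmax hJ hJ𝓐
    induction hJne using Finset.Nonempty.cons_induction with
    | singleton B => simpa using hJall
    | cons B J _ _ ih =>
      have h1 := hJall B (Finset.mem_cons_self _ _)
      have h2 := ih fun B' hB' => hJall B' (Finset.mem_cons_of_mem hB')
      rw [Finset.inf_cons]
      exact ⟨⟨h1.1.1.inter_right h2.1.1.isClosed, isOpen_normalizer_inf h1.1.2 h2.1.2⟩,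
        localStabilizer_inf_eq_top h1.2 h2.2⟩
  refine hJ (eq_bot_of_eventually_mem_eq_one hQZ hBn.1.2
    (eventually_mem_eq_one hnormal hUc hF hBn.1 hBn.2 fun f hf => ?_))
  rcases hmax (K f) (Finset.mem_image_of_mem K hf) with hfJ | hfJ
  · exact Eventually.of_forall fun y hy => hfc f hf y (mem_finset_inf_id.1 hy _ hfJ)
  · have hfB : f ∈ localStabilizer (J.inf id) := hBn.2 ▸ Subgroup.mem_top f
    filter_upwards [mem_localStabilizer.1 hfB, eventually_mem_of_isOpen (hK f).2] with y h1 h2 hy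
    -- The commutator of `f` and `y` lies in `K f`, and also in the maximal intersection.
    have hmem : f * y * f⁻¹ * y⁻¹ ∈ K f ⊓ J.inf id := by
      refine ⟨?_, (J.inf id).mul_mem (h1.1 hy) ((J.inf id).inv_mem hy)⟩
      have := (K f).mul_mem (hfK f hf)
        ((Subgroup.mem_normalizer_iff.1 h2 _).1 ((K f).inv_mem (hfK f hf)))
      simpa [mul_assoc] using this
    rw [hfJ, Subgroup.mem_bot] at hmem
    exact mul_inv_eq_iff_eq_mul.1 (mul_inv_eq_one.1 hmem)

/-! ### Reduction of the virtually soluble case to the abelian case -/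

theorem commutator_topologicalClosure_le (N : Subgroup G) :
    ⁅N.topologicalClosure, N.topologicalClosure⁆ ≤ (⁅N, N⁆ : Subgroup G).topologicalClosure := by
  rw [Subgroup.commutator_le]
  intro x hx y hy
  have hc : Continuous fun p : G × G => ⁅p.1, p.2⁆ := by
    simp only [commutatorElement_def]
    fun_prop
  exact map_mem_closure₂ hc hx hy fun a ha b hb => Subgroup.commutator_mem_commutator ha hb

theorem normalizer_le_normalizer_topologicalClosure_commutator (K : Subgroup G) :
    Subgroup.normalizer (K : Set G) ≤
      Subgroup.normalizer ((⁅K, K⁆ : Subgroup G).topologicalClosure : Set G) := by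
  rw [Subgroup.le_normalizer_iff]
  intro g hg
  have : (⁅K, K⁆ : Subgroup G).topologicalClosure ≤
      (⁅K, K⁆ : Subgroup G).topologicalClosure.comap (MulAut.conj g).toMonoidHom := by
    refine Subgroup.topologicalClosure_minimal _ ?_
      ((Subgroup.isClosed_topologicalClosure _).preimage (f := fun x : G => g * x * g⁻¹)
        (by fun_prop))
    rw [Subgroup.commutator_le]
    intro x hx y hy
    rw [Subgroup.mem_comap, map_commutatorElement]
    exact Subgroup.le_topologicalClosure _ (Subgroup.commutator_mem_commutator
      ((Subgroup.mem_normalizer_iff.1 hg x).1 hx) ((Subgroup.mem_normalizer_iff.1 hg y).1 hy))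
  exact this

/-- If every abelian locally normal subgroup is trivial, then so is every locally normal subgroup
contained in the closure of a soluble subgroup. The closure is there because the derived subgroup of a compact group
need not be closed; the soluble subgroup is one whose `n`-th derived subgroup vanishes. -/
theorem IsLocallyNormal.eq_bot_of_le_closure [T2Space G]
    (habelian : ∀ A : Subgroup G, IsLocallyNormal A → (∀ x ∈ A, ∀ y ∈ A, x * y = y * x) → A = ⊥)
    (n : ℕ) : ∀ (K N : Subgroup G), IsLocallyNormal K → K ≤ N.topologicalClosure →
      (fun H : Subgroup G => ⁅H, H⁆)^[n] N = ⊥ → K = ⊥ := by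
  induction n with
  | zero =>
    intro K N _ hKN hN
    rw [Function.iterate_zero_apply] at hN
    rw [eq_bot_iff]
    refine hKN.trans (Subgroup.topologicalClosure_minimal _ hN.le ?_)
    rw [Subgroup.coe_bot]
    exact isClosed_singleton
  | succ n ih =>
    intro K N hK hKN hN
    have hle : (⁅K, K⁆ : Subgroup G).topologicalClosure ≤ K :=
      Subgroup.topologicalClosure_minimal _
        (Subgroup.commutator_le.2 fun x hx y hy => by
          rw [commutatorElement_def]
          exact K.mul_mem (K.mul_mem (K.mul_mem hx hy) (K.inv_mem hx)) (K.inv_mem hy))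
        hK.1.isClosed
    have hbot := ih (⁅K, K⁆ : Subgroup G).topologicalClosure ⁅N, N⁆
      ⟨hK.1.of_isClosed_subset (Subgroup.isClosed_topologicalClosure _) hle,
        Subgroup.isOpen_mono (normalizer_le_normalizer_topologicalClosure_commutator K) hK.2⟩
      (Subgroup.topologicalClosure_minimal _
        ((Subgroup.commutator_mono hKN hKN).trans (commutator_topologicalClosure_le N))
        (Subgroup.isClosed_topologicalClosure _)) hN
    refine habelian K hK fun x hx y hy => ?_
    have : ⁅x, y⁆ ∈ (⁅K, K⁆ : Subgroup G).topologicalClosure :=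
      Subgroup.le_topologicalClosure _ (Subgroup.commutator_mem_commutator hx hy)
    rw [hbot, Subgroup.mem_bot] at this
    exact commutatorElement_eq_one_iff_mul_comm.1 this

theorem iterate_commutator_range {G H : Type*} [Group G] [Group H] (f : H →* G) (n : ℕ) :
    (fun L : Subgroup G => ⁅L, L⁆)^[n] f.range = (derivedSeries H n).map f := by
  induction n with
  | zero => simp [MonoidHom.range_eq_map]
  | succ n ih =>
    rw [Function.iterate_succ_apply', ih, derivedSeries_succ, Subgroup.map_commutator]

theorem IsLocallyNormal.eq_bot_of_isVirtuallySoluble [LocallyCompactSpace G]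
    [TotallyDisconnectedSpace G] [T2Space G] (hQZ : quasiCentre G = ⊥)
    (habelian : ∀ A : Subgroup G, IsLocallyNormal A → (∀ x ∈ A, ∀ y ∈ A, x * y = y * x) → A = ⊥)
    {K : Subgroup G} (hK : IsLocallyNormal K) (hvs : IsVirtuallySoluble K) : K = ⊥ := by
  obtain ⟨N, ⟨n, hn⟩, hNfin⟩ := hvs
  have hfin : N.topologicalClosure.FiniteIndex :=
    Subgroup.finiteIndex_of_le N.le_topologicalClosure
  have hopen : IsOpen (N.topologicalClosure : Set K) :=
    Subgroup.isOpen_of_isClosed_of_finiteIndex _ N.isClosed_topologicalClosure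
  have hrange : (K.subtype.comp N.subtype).range = N.map K.subtype := by
    rw [MonoidHom.range_comp, Subgroup.range_subtype]
  have hev : ∀ᶠ x in 𝓝 (1 : G), x ∈ K → x ∈ (N.map K.subtype).topologicalClosure := by
    have h1 := eventually_mem_of_isOpen hopen
    rw [nhds_subtype_eq_comap, eventually_comap] at h1
    filter_upwards [h1] with x hx hxK
    have h2 : (⟨x, hxK⟩ : K) ∈ closure (N : Set K) := hx ⟨x, hxK⟩ rfl
    exact map_mem_closure continuous_subtype_val h2 fun y hy => ⟨y, hy, rfl⟩
  obtain ⟨W, hWo, hWc, hW⟩ := exists_compact_open_subgroup hev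
  have hbot : K ⊓ W = ⊥ := IsLocallyNormal.eq_bot_of_le_closure habelian n (K ⊓ W)
    (N.map K.subtype)
    ⟨hK.1.inter_right hWc.isClosed, isOpen_normalizer_inf hK.2 (isOpen_normalizer_of_isOpen hWo)⟩
    (fun x hx => hW hx.2 hx.1)
    (by rw [← hrange, iterate_commutator_range, hn, Subgroup.map_bot])
  refine eq_bot_of_eventually_mem_eq_one hQZ hK.2 ?_
  filter_upwards [eventually_mem_of_isOpen hWo] with x hxW hxK
  have : x ∈ K ⊓ W := ⟨hxK, hxW⟩
  simpa [hbot] using this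

end TDLC

theorem theoremA {G : Type*} [Group G] [TopologicalSpace G] [IsTopologicalGroup G]
    [LocallyCompactSpace G] [TotallyDisconnectedSpace G]
    (hcg : TDLC.IsCompactlyGeneratedGroup G)
    (hsimple : TDLC.IsTopCharSimple G)
    (hdiscrete : ¬ DiscreteTopology G)
    (hcompact : ¬ CompactSpace G) :
    TDLC.quasiCentre G = ⊥ ∧
      ∀ K : Subgroup G, (TDLC.IsLocallyNormal K ∧ TDLC.IsVirtuallySoluble K) ↔ K = ⊥ := by
  have := TDLC.t2Space_of_totallyDisconnected (G := G)
  obtain ⟨U, hUo, hUc, -⟩ := TDLC.exists_compact_open_subgroup (G := G) Filter.univ_mem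
  have hnormal : ∀ N : Subgroup G, IsCompact (N : Set G) → N.Normal → N = ⊥ := fun _ =>
    TDLC.eq_bot_of_isCompact_of_normal hcg hsimple hcompact hUo hUc
  have hQZ := TDLC.quasiCentre_eq_bot hcg hsimple hdiscrete hnormal
  refine ⟨hQZ, fun K => ⟨fun hK => hK.1.eq_bot_of_isVirtuallySoluble hQZ ?_ hK.2, ?_⟩⟩
  · intro A hA hab
    by_contra hA1
    obtain ⟨E, hE, hstab, hcentre⟩ :=
      TDLC.exists_localStabilizer_eq_top hcg hsimple hcompact hQZ hA hab hA1
    exact hcentre (TDLC.inf_centralizer_eq_bot hcg hsimple hcompact hQZ hnormal hE hstab)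
  · rintro rfl
    refine ⟨⟨by simp, ?_⟩, ⊤, inferInstance, inferInstance⟩
    rw [Subgroup.normalizer_eq_top]
    exact isOpen_univ
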